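/- Let $d\ge 3$, $n\in\mathbb N_0$ and $\lambda=\frac{d-2}{2}$. Let $\mathbb S^{d-1}$ be the unit sphere of $\mathbb R^d$, $\sigma$ its surface area measure and $\omega_d=\int_{\mathbb S^{d-1}}d\sigma$. Let $\mathcal H_n^d$ be the space of real harmonic polynomials on $\mathbb R^d$ that are homogeneous of degree $n$, equipped with the inner product $\langle f,g\rangle_{\mathbb S^{d-1}}=\frac1{\omega_d}\int_{\mathbb S^{d-1}}f g\,d\sigma$. Let $C_n^\lambda$ be the Gegenbauer polynomial $$C_n^\lambda(t)=\frac{(\lambda)_n2^n}{n!}\,t^n\,{}_2F_1\!\left(-\tfrac n2,\tfrac{1-n}2;1-n-\lambda;\tfrac1{t^2}\right)=\frac{(\lambda)_n2^n}{n!}\sum_{j=0}^{\lfloor n/2\rfloor}\frac{(-\frac n2)_j(\frac{1-n}2)_j}{j!\,(1-n-\lambda)_j}\,t^{n-2j},$$ where $(a)_j=a(a+1)\cdots(a+j-1)$ and the last sum gives the value also at $t=0$. (i) There is exactly one function $Z_n:\mathbb S^{d-1}\times\mathbb S^{d-1}\to\mathbb R$ such that for each $x\in\mathbb S^{d-1}$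 the function $Z_n(x,\cdot)$ is the restriction to $\mathbb S^{d-1}$ of an element of $\mathcal H_n^d$, and $$\frac1{\omega_d}\int_{\mathbb S^{d-1}}Z_n(x,y)p(y)\,d\sigma(y)=p(x)\qquad\text{for all }p\in\mathcal H_n^d,\ x\in\mathbb S^{d-1}$$ (the reproducing kernel of $\mathcal H_n^d$), and it satisfies $$Z_n(x,y)=\frac{n+\lambda}{\lambda}\,C_n^\lambda(\langle x,y\rangle)\qquad\text{for all }x,y\in\mathbb S^{d-1}.$$ (ii) For every basis $\{Y_j\}$ of $\mathcal H_n^d$ that is orthonormal for $\langle\cdot,\cdot\rangle_{\mathbb S^{d-1}}$, $$\sum_{j=1}^{\dim\mathcal H_n^d}Y_j(x)Y_j(y)=\frac{n+\lambda}{\lambda}\,C_n^\lambda(\langle x,y\rangle)\qquad\text{for all }x,y\in\mathbb S^{d-1}.$$ -/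

import Mathlib

open MeasureTheory
open scoped Nat

noncomputable section

/-- The Laplacian `Δ = ∂₁² + ⋯ + ∂_d²` on real polynomials in `d` variables. -/
def polyLaplacian (d : ℕ) : MvPolynomial (Fin d) ℝ →ₗ[ℝ] MvPolynomial (Fin d) ℝ :=
  ∑ i : Fin d, (MvPolynomial.pderiv i).toLinearMap ∘ₗ (MvPolynomial.pderiv i).toLinearMap

/-- The space `H_n^d` of real harmonic polynomials on `ℝ^d`, homogeneous of degree `n`. -/
def harmonicPoly (d n : ℕ) : Submodule ℝ (MvPolynomial (Fin d) ℝ) :=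
  MvPolynomial.homogeneousSubmodule (Fin d) ℝ n ⊓ LinearMap.ker (polyLaplacian d)

/-- The unit sphere `S^{d-1}` of `ℝ^d` with its Euclidean norm. -/
abbrev UnitSphere (d : ℕ) : Type := Metric.sphere (0 : EuclideanSpace ℝ (Fin d)) 1

/-- The restriction of a polynomial to the unit sphere. -/
def restrictSphere {d : ℕ} (p : MvPolynomial (Fin d) ℝ) (x : UnitSphere d) : ℝ :=
  MvPolynomial.eval (fun i => (x : EuclideanSpace ℝ (Fin d)) i) p

/-- The surface area measure `σ` on the unit sphere. -/
def surfaceMeasure (d : ℕ) : Measure (UnitSphere d) :=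
  (volume : Measure (EuclideanSpace ℝ (Fin d))).toSphere

/-- The total surface area `ω_d = ∫_{S^{d-1}} dσ`. -/
def sphereArea (d : ℕ) : ℝ := ∫ _ : UnitSphere d, (1 : ℝ) ∂(surfaceMeasure d)

/-- The normalized inner product `⟨f, g⟩ = (1 / ω_d) ∫_{S^{d-1}} f g dσ`. -/
def sphereInner {d : ℕ} (f g : UnitSphere d → ℝ) : ℝ :=
  1 / sphereArea d * ∫ y, f y * g y ∂(surfaceMeasure d)

/-- `Z` is a reproducing kernel of `H_n^d`: each `Z(x, ·)` is (the restriction to the sphere of) an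
element of `H_n^d`, and `(1 / ω_d) ∫ Z(x, y) p(y) dσ(y) = p(x)` for all `p ∈ H_n^d` and all `x` in
the sphere. -/
structure IsReproducingKernel (d n : ℕ) (Z : UnitSphere d → UnitSphere d → ℝ) : Prop where
  mem : ∀ x, ∃ q ∈ harmonicPoly d n, Z x = restrictSphere q
  reproducing : ∀ p ∈ harmonicPoly d n, ∀ x,
    sphereInner (Z x) (restrictSphere p) = restrictSphere p x

/-- A family in `H_n^d` is orthonormal for the normalized inner product on the sphere. -/
structure IsSphereOrthonormal {d n : ℕ} {ι : Type*} (Y : ι → harmonicPoly d n) : Prop where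
  norm_one : ∀ i, sphereInner (restrictSphere (Y i : MvPolynomial (Fin d) ℝ))
    (restrictSphere (Y i : MvPolynomial (Fin d) ℝ)) = 1
  orthogonal : ∀ i j, i ≠ j → sphereInner (restrictSphere (Y i : MvPolynomial (Fin d) ℝ))
    (restrictSphere (Y j : MvPolynomial (Fin d) ℝ)) = 0

/-- The Pochhammer symbol `(a)_n = a (a + 1) ⋯ (a + n - 1)`. -/
def poch (a : ℝ) (n : ℕ) : ℝ := (ascPochhammer ℝ n).eval a

/-- The Gegenbauer polynomial
`C_n^λ(t) = ((λ)_n 2^n / n!) t^n ₂F₁(-n/2, (1-n)/2; 1-n-λ; 1/t²)`, used for `λ > 0`. The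
hypergeometric series terminates, the factor `(-n/2)_j ((1-n)/2)_j` being `0` for `j > ⌊n/2⌋`, and
is written out here, so that the polynomial has its right value at `t = 0` too; see
`gegenbauer_eval_eq_hypergeometric`. -/
def gegenbauer (lam : ℝ) (n : ℕ) : Polynomial ℝ :=
  Polynomial.C (poch lam n * 2 ^ n / n !) *
    ∑ j ∈ Finset.range (n / 2 + 1),
      Polynomial.C (poch (-(n : ℝ) / 2) j * poch ((1 - (n : ℝ)) / 2) j /
        (poch (1 - (n : ℝ) - lam) j * j !)) * Polynomial.X ^ (n - 2 * j)

lemma poch_eq_zero_of_lt (n j : ℕ) (h : n / 2 < j) :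
    poch (-(n : ℝ) / 2) j * poch ((1 - (n : ℝ)) / 2) j = 0 := by
  obtain ⟨k, hk | hk⟩ := Nat.even_or_odd' n
  · have h1 : (-(n : ℝ) / 2) = -(k : ℝ) := by subst hk; push_cast; ring
    rw [h1, poch, ascPochhammer_eval_neg_coe_nat_of_lt (by omega), zero_mul]
  · have h1 : ((1 - (n : ℝ)) / 2) = -(k : ℝ) := by subst hk; push_cast; ring
    rw [h1, poch, poch, ascPochhammer_eval_neg_coe_nat_of_lt (by omega), mul_zero]

/-- The Gegenbauer polynomial agrees with its hypergeometric formula wherever the latter makes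
sense, that is, for `t ≠ 0`. -/
theorem gegenbauer_eval_eq_hypergeometric (lam : ℝ) (n : ℕ) (t : ℝ) (ht : t ≠ 0) :
    (gegenbauer lam n).eval t = poch lam n * 2 ^ n / n ! * t ^ n *
      ordinaryHypergeometric (-(n : ℝ) / 2) ((1 - (n : ℝ)) / 2) (1 - (n : ℝ) - lam)
        (1 / t ^ 2) := by
  rw [ordinaryHypergeometric, ordinaryHypergeometric_sum_eq, tsum_eq_sum (s := Finset.range (n / 2 + 1))]
  · simp only [gegenbauer, Polynomial.eval_mul, Polynomial.eval_C, Polynomial.eval_finsetSum,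
      Polynomial.eval_pow, Polynomial.eval_X]
    rw [mul_assoc, Finset.mul_sum (a := t ^ n)]
    congr 1
    refine Finset.sum_congr rfl fun j hj => ?_
    have hj' : 2 * j ≤ n := by rw [Finset.mem_range] at hj; omega
    rw [pow_sub₀ t ht hj', pow_mul]
    simp only [poch, smul_eq_mul, div_eq_mul_inv, mul_inv]
    ring
  · intro j hj
    have h := poch_eq_zero_of_lt n j (by rw [Finset.mem_range] at hj; omega)
    simp only [poch] at h
    rw [mul_assoc ((j ! : ℝ)⁻¹), h]
    simp

end

/-! Homogenize the right-hand side: `zonalPoly` replaces `t^(n-2j)` in `(n+λ)/λ * C_n^λ(t)` by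
`|y|^(2j) ⟨x,y⟩^(n-2j)`, and this explicit polynomial is shown to be the kernel. It is harmonic
because the Laplacians of consecutive terms cancel (`polyLaplacian_zonalPoly`).

It reproduces because, on the sphere, only the means of `⟨x,y⟩^(n-2j) p(y)` matter: they vanish for
`j > 0`, and for `j = 0` give a constant times `p(x)` (`sphereMean_linearFormPoly_pow_mul`). These
means come from Gaussian integrals: Stein's identity trades a factor `⟨x,y⟩` for a derivative along
`x`, and polar coordinates convert Gaussian integrals of homogeneous polynomials into spherical
means.

Uniqueness follows by pairing any kernel with the symmetric zonal one; (ii) is the expansion of the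
zonal kernel in the orthonormal basis. -/

noncomputable section

open MvPolynomial

/-! ### Gaussian integrals of polynomials -/

lemma integrable_pow_mul_exp_neg_half_sq (a : ℕ) :
    Integrable fun t : ℝ => t ^ a * Real.exp (-(1 / 2) * t ^ 2) := by
  have h := integrable_rpow_mul_exp_neg_mul_sq (b := 1 / 2) (by norm_num) (s := (a : ℝ))
    (by linarith [(Nat.cast_nonneg a : (0 : ℝ) ≤ a)])
  simpa only [Real.rpow_natCast] using h

/-- The unnormalized Gaussian moment `∫ t ^ a * exp (-t² / 2) dt`. -/
def gaussianMoment (a : ℕ) : ℝ := ∫ t : ℝ, t ^ a * Real.exp (-(1 / 2) * t ^ 2)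

lemma gaussianMoment_zero_pos : 0 < gaussianMoment 0 := by
  have h := integral_gaussian (1 / 2)
  simp only [gaussianMoment, pow_zero, one_mul]
  rw [h]
  positivity

/-- Integration by parts against `-exp(-t²/2)`, a primitive of `t exp(-t²/2)`. At `a = 0` the
truncated `a - 1` is harmless, its factor being zero. -/
lemma gaussianMoment_succ (a : ℕ) :
    gaussianMoment (a + 1) = a * gaussianMoment (a - 1) := by
  have hv : ∀ t : ℝ, HasDerivAt (fun t : ℝ => -Real.exp (-(1 / 2) * t ^ 2))
      (t * Real.exp (-(1 / 2) * t ^ 2)) t := fun t => by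
    have h := (((hasDerivAt_pow 2 t).const_mul (-(1 / 2 : ℝ))).exp).neg
    convert! h using 1
    push_cast
    ring
  have h := integral_mul_deriv_eq_deriv_mul_of_integrable
    (u := fun t : ℝ => t ^ a) (u' := fun t => (a : ℝ) * t ^ (a - 1))
    (v := fun t : ℝ => -Real.exp (-(1 / 2) * t ^ 2))
    (v' := fun t : ℝ => t * Real.exp (-(1 / 2) * t ^ 2))
    (fun t _ => hasDerivAt_pow a t) (fun t _ => hv t)
    ((integrable_pow_mul_exp_neg_half_sq (a + 1)).congr (.of_forall fun t => by
      simp only [Pi.mul_apply]; ring))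
    (((integrable_pow_mul_exp_neg_half_sq (a - 1)).const_mul (-(a : ℝ))).congr
      (.of_forall fun t => by simp only [Pi.mul_apply]; ring))
    ((integrable_pow_mul_exp_neg_half_sq a).neg.congr (.of_forall fun t => by
      simp only [Pi.mul_apply, Pi.neg_apply]; ring))
  rw [gaussianMoment, gaussianMoment, ← integral_const_mul, ← integral_neg] at *
  refine Eq.trans (integral_congr_ae (.of_forall fun t => ?_))
    (h.trans (integral_congr_ae (.of_forall fun t => ?_)))
  · change _ = t ^ a * (t * _)
    ring
  · ring

lemma monomial_mul_exp_eq_prod {d : ℕ} (s : Fin d →₀ ℕ) (y : EuclideanSpace ℝ (Fin d)) :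
    eval (fun i => y i) (monomial s (1 : ℝ)) * Real.exp (-(1 / 2) * ‖y‖ ^ 2) =
      ∏ i, (y i ^ s i * Real.exp (-(1 / 2) * y i ^ 2)) := by
  rw [eval_monomial, one_mul, Finset.prod_mul_distrib, ← Real.exp_sum, EuclideanSpace.norm_sq_eq,
    Finsupp.prod_fintype _ _ (fun _ => pow_zero _), Finset.mul_sum]
  simp

lemma integrable_eval_mul_exp {d : ℕ} (p : MvPolynomial (Fin d) ℝ) :
    Integrable fun y : EuclideanSpace ℝ (Fin d) =>
      eval (fun i => y i) p * Real.exp (-(1 / 2) * ‖y‖ ^ 2) := by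
  induction p using MvPolynomial.induction_on' with
  | monomial s a =>
    have h : Integrable fun y : EuclideanSpace ℝ (Fin d) =>
        eval (fun i => y i) (monomial s (1 : ℝ)) * Real.exp (-(1 / 2) * ‖y‖ ^ 2) := by
      simp_rw [monomial_mul_exp_eq_prod]
      exact (PiLp.volume_preserving_ofLp (Fin d)).integrable_comp_of_integrable
        (g := fun y : Fin d → ℝ => ∏ i, (y i ^ s i * Real.exp (-(1 / 2) * y i ^ 2)))
        (Integrable.fintype_prod fun i => integrable_pow_mul_exp_neg_half_sq (s i))
    refine (h.const_mul a).congr (.of_forall fun y => ?_)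
    simp only [eval_monomial]
    ring
  | add p q hp hq =>
    refine (hp.add hq).congr (.of_forall fun y => ?_)
    simp [add_mul]

/-- The unnormalized Gaussian integral `∫ p(y) exp (-|y|² / 2) dy` of a polynomial. -/
def gaussianIntegral (d : ℕ) : MvPolynomial (Fin d) ℝ →ₗ[ℝ] ℝ where
  toFun p := ∫ y : EuclideanSpace ℝ (Fin d),
    eval (fun i => y i) p * Real.exp (-(1 / 2) * ‖y‖ ^ 2)
  map_add' p q := by
    rw [← integral_add (integrable_eval_mul_exp p) (integrable_eval_mul_exp q)]
    simp only [map_add, add_mul]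
  map_smul' c p := by
    simp only [smul_eval, RingHom.id_apply, smul_eq_mul, mul_assoc]
    rw [integral_const_mul]

lemma gaussianIntegral_apply {d : ℕ} (p : MvPolynomial (Fin d) ℝ) :
    gaussianIntegral d p = ∫ y : EuclideanSpace ℝ (Fin d),
      eval (fun i => y i) p * Real.exp (-(1 / 2) * ‖y‖ ^ 2) := rfl

lemma gaussianIntegral_C_mul {d : ℕ} (c : ℝ) (p : MvPolynomial (Fin d) ℝ) :
    gaussianIntegral d (C c * p) = c * gaussianIntegral d p := by
  rw [C_mul', map_smul, smul_eq_mul]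

lemma gaussianIntegral_monomial_one {d : ℕ} (s : Fin d →₀ ℕ) :
    gaussianIntegral d (monomial s 1) = ∏ i, gaussianMoment (s i) := by
  rw [gaussianIntegral_apply]
  simp_rw [monomial_mul_exp_eq_prod]
  rw [(PiLp.volume_preserving_ofLp (Fin d)).integral_comp
    (MeasurableEquiv.toLp 2 (Fin d → ℝ)).symm.measurableEmbedding
    (fun y : Fin d → ℝ => ∏ i, (y i ^ s i * Real.exp (-(1 / 2) * y i ^ 2)))]
  exact integral_fintype_prod_volume_eq_prod
    (fun i (t : ℝ) => t ^ s i * Real.exp (-(1 / 2) * t ^ 2))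

lemma gaussianIntegral_one_pos (d : ℕ) : 0 < gaussianIntegral d 1 := by
  have h := gaussianIntegral_monomial_one (d := d) 0
  rw [← C_apply, C_1] at h
  rw [h]
  exact Finset.prod_pos fun _ _ => gaussianMoment_zero_pos

/-- Gaussian integration by parts (Stein's identity) for polynomials. -/
lemma gaussianIntegral_X_mul {d : ℕ} (i : Fin d) (p : MvPolynomial (Fin d) ℝ) :
    gaussianIntegral d (X i * p) = gaussianIntegral d (pderiv i p) := by
  induction p using MvPolynomial.induction_on' with
  | monomial s a =>
    have h1 : X i * monomial s a = C a * monomial (Finsupp.single i 1 + s) (1 : ℝ) := by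
      rw [X, monomial_mul, C_mul_monomial, one_mul, mul_one]
    have h2 : pderiv i (monomial s a) =
        C (a * s i) * monomial (s - Finsupp.single i 1) (1 : ℝ) := by
      rw [pderiv_monomial, C_mul_monomial, mul_one]
    rw [h1, h2, gaussianIntegral_C_mul, gaussianIntegral_C_mul, gaussianIntegral_monomial_one,
      gaussianIntegral_monomial_one, mul_assoc,
      ← Finset.mul_prod_erase _ _ (Finset.mem_univ i),
      ← Finset.mul_prod_erase Finset.univ
        (fun j => gaussianMoment ((s - Finsupp.single i 1 : Fin d →₀ ℕ) j)) (Finset.mem_univ i)]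
    have h3 : ∀ j ∈ Finset.univ.erase i, gaussianMoment ((Finsupp.single i 1 + s : Fin d →₀ ℕ) j) =
        gaussianMoment ((s - Finsupp.single i 1 : Fin d →₀ ℕ) j) := fun j hj => by
      have hij : i ≠ j := (Finset.ne_of_mem_erase hj).symm
      simp [Finsupp.single_eq_of_ne' hij]
    rw [Finset.prod_congr rfl h3]
    simp only [Finsupp.add_apply, Finsupp.tsub_apply, Finsupp.single_eq_same, add_comm 1,
      gaussianMoment_succ]
    ring
  | add p q hp hq => rw [mul_add, map_add, map_add, map_add, hp, hq]

/-! ### Means over the sphere -/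

lemma continuous_restrictSphere {d : ℕ} (p : MvPolynomial (Fin d) ℝ) :
    Continuous (restrictSphere p) := by
  unfold restrictSphere
  have h := MvPolynomial.continuous_eval p
  fun_prop

instance isFiniteMeasure_surfaceMeasure (d : ℕ) : IsFiniteMeasure (surfaceMeasure d) := by
  unfold surfaceMeasure
  infer_instance

lemma integrable_restrictSphere {d : ℕ} (p : MvPolynomial (Fin d) ℝ) :
    Integrable (restrictSphere p) (surfaceMeasure d) :=
  (continuous_restrictSphere p).integrable_of_hasCompactSupport
    (HasCompactSupport.of_compactSpace _)

/-- The mean `(1 / ω_d) ∫ p dσ` of a polynomial over the sphere. -/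
def sphereMean (d : ℕ) : MvPolynomial (Fin d) ℝ →ₗ[ℝ] ℝ where
  toFun p := 1 / sphereArea d * ∫ y, restrictSphere p y ∂(surfaceMeasure d)
  map_add' p q := by
    rw [← mul_add, ← integral_add (integrable_restrictSphere p) (integrable_restrictSphere q)]
    simp only [restrictSphere, map_add]
  map_smul' c p := by
    simp only [restrictSphere, smul_eval, RingHom.id_apply, smul_eq_mul]
    rw [integral_const_mul]
    ring

lemma sphereInner_restrictSphere {d : ℕ} (p q : MvPolynomial (Fin d) ℝ) :
    sphereInner (restrictSphere p) (restrictSphere q) = sphereMean d (p * q) := by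
  simp [sphereInner, sphereMean, restrictSphere]

lemma eval_smul_of_isHomogeneous {σ : Type*} {m : ℕ} {p : MvPolynomial σ ℝ}
    (hp : p.IsHomogeneous m) (r : ℝ) (x : σ → ℝ) :
    eval (fun i => r * x i) p = r ^ m * eval x p := by
  simp only [eval_eq, Finset.mul_sum]
  refine Finset.sum_congr rfl fun s hs => ?_
  have h : ∑ i ∈ s.support, s i = m := by
    have h1 : s.degree = m := by
      rw [Finsupp.degree_eq_weight_one]
      exact hp (mem_support_iff.mp hs)
    rwa [Finsupp.degree_apply] at h1
  simp_rw [mul_pow]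
  rw [Finset.prod_mul_distrib, Finset.prod_pow_eq_pow_sum, h]
  ring

/-- Polar coordinates: the Gaussian integral of a homogeneous polynomial. -/
lemma exists_gaussianIntegral_eq_mul_integral_restrictSphere (d m : ℕ) (hd : 0 < d) : ∃ c : ℝ,
    ∀ p : MvPolynomial (Fin d) ℝ, p.IsHomogeneous m →
      gaussianIntegral d p = c * ∫ y, restrictSphere p y ∂(surfaceMeasure d) := by
  have : Nonempty (Fin d) := ⟨⟨0, hd⟩⟩
  let E := EuclideanSpace ℝ (Fin d)
  -- The radial integral of `r^m exp(-r²/2)` with weight `r^(d-1)`. It depends only on `d` and `m`,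
  -- and its value is never needed.
  refine ⟨∫ r : Set.Ioi (0 : ℝ), (r : ℝ) ^ m * Real.exp (-(1 / 2) * (r : ℝ) ^ 2)
    ∂(Measure.volumeIoiPow (Module.finrank ℝ E - 1)), fun p hp => ?_⟩
  let f : E → ℝ := fun y => eval (fun i => y i) p * Real.exp (-(1 / 2) * ‖y‖ ^ 2)
  have h1 : gaussianIntegral d p =
      ∫ y : ({(0 : E)}ᶜ : Set E), f y ∂((volume : Measure E).comap Subtype.val) := by
    rw [integral_subtype_comap (measurableSet_singleton (0 : E)).compl f,
      restrict_compl_singleton]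
    rfl
  have h2 := (volume : Measure E).measurePreserving_homeomorphUnitSphereProd.integral_comp
    (Homeomorph.measurableEmbedding _)
    (fun z => f ((homeomorphUnitSphereProd E).symm z))
  simp only [Homeomorph.symm_apply_apply] at h2
  rw [h1, h2, mul_comm]
  rw [← integral_prod_mul (μ := surfaceMeasure d) (restrictSphere p)]
  refine integral_congr_ae (.of_forall fun z => ?_)
  have hr : (0 : ℝ) < z.2 := z.2.2
  have hz : ‖(z.2 : ℝ) • (z.1 : E)‖ = z.2 := by
    rw [norm_smul, norm_eq_of_mem_sphere, mul_one, Real.norm_of_nonneg hr.le]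
  simp only [f, homeomorphUnitSphereProd_symm_apply_coe, hz, restrictSphere]
  have he := eval_smul_of_isHomogeneous hp (z.2 : ℝ) (fun i => (z.1 : E) i)
  change eval (fun i => (z.2 : ℝ) * (z.1 : E) i) p * _ = _
  rw [he]
  ring

lemma sphereArea_ne_zero {d : ℕ} (hd : 0 < d) : sphereArea d ≠ 0 := by
  obtain ⟨c, hc⟩ := exists_gaussianIntegral_eq_mul_integral_restrictSphere d 0 hd
  have h := hc 1 (isHomogeneous_one _ _)
  have h1 : ∫ y, restrictSphere 1 y ∂(surfaceMeasure d) = sphereArea d := by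
    simp [restrictSphere, sphereArea]
  rw [h1] at h
  intro h0
  rw [h0, mul_zero] at h
  exact (gaussianIntegral_one_pos d).ne' h

/-- The polynomial `x₁² + ⋯ + x_d²`. -/
def normSqPoly (d : ℕ) : MvPolynomial (Fin d) ℝ := ∑ i, X i * X i

lemma restrictSphere_normSqPoly {d : ℕ} (x : UnitSphere d) :
    restrictSphere (normSqPoly d) x = 1 := by
  have h := EuclideanSpace.norm_sq_eq (x : EuclideanSpace ℝ (Fin d))
  rw [norm_eq_of_mem_sphere] at h
  simp only [restrictSphere, normSqPoly, map_sum, map_mul, eval_X]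
  simpa [← pow_two] using h.symm

lemma isHomogeneous_normSqPoly (d : ℕ) : (normSqPoly d).IsHomogeneous 2 :=
  IsHomogeneous.sum _ _ _ fun i _ => (isHomogeneous_X ℝ i).mul (isHomogeneous_X ℝ i)

/-- The Gaussian integral of a homogeneous polynomial in terms of its mean over the sphere. -/
lemma gaussianIntegral_eq_mul_sphereMean {d k : ℕ} (hd : 0 < d) {p : MvPolynomial (Fin d) ℝ}
    (hp : p.IsHomogeneous (2 * k)) :
    gaussianIntegral d p = gaussianIntegral d (normSqPoly d ^ k) * sphereMean d p := by
  -- The radial constant is eliminated by comparison with `|y|^(2k)`, which has the same degree and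
  -- equals 1 on the sphere.
  obtain ⟨c, hc⟩ := exists_gaussianIntegral_eq_mul_integral_restrictSphere d (2 * k) hd
  have h1 : ∫ y, restrictSphere (normSqPoly d ^ k) y ∂(surfaceMeasure d) = sphereArea d := by
    have h : ∀ y : UnitSphere d, restrictSphere (normSqPoly d ^ k) y = 1 := fun y => by
      have h0 := restrictSphere_normSqPoly y
      unfold restrictSphere at h0 ⊢
      rw [map_pow, h0, one_pow]
    simp_rw [h]
    rfl
  rw [hc p hp, hc _ ((isHomogeneous_normSqPoly d).pow k), h1]
  simp only [sphereMean, LinearMap.coe_mk, AddHom.coe_mk]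
  field_simp [sphereArea_ne_zero hd]

/-! ### Gaussian integrals of powers of linear forms times harmonic polynomials -/

lemma polyLaplacian_apply {d : ℕ} (p : MvPolynomial (Fin d) ℝ) :
    polyLaplacian d p = ∑ i, pderiv i (pderiv i p) := by
  simp [polyLaplacian, LinearMap.sum_apply]

/-- The commutator of two derivations is a derivation, and this one kills every variable. -/
lemma pderiv_pderiv_comm {σ : Type*} (i j : σ) (p : MvPolynomial σ ℝ) :
    pderiv i (pderiv j p) = pderiv j (pderiv i p) := by
  classical
  have h : ⁅pderiv (R := ℝ) i, pderiv (R := ℝ) j⁆ = 0 := by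
    refine derivation_ext fun k => ?_
    rw [Derivation.commutator_apply, pderiv_X, pderiv_X]
    simp only [Pi.single_apply, apply_ite (pderiv i), apply_ite (pderiv j), pderiv_one, map_zero,
      ite_self, sub_zero, Derivation.zero_apply]
  have h1 := congrArg
    (fun D : Derivation ℝ (MvPolynomial σ ℝ) (MvPolynomial σ ℝ) => D p) h
  rwa [Derivation.commutator_apply, Derivation.zero_apply, sub_eq_zero] at h1

lemma pderiv_mem_harmonicPoly {d n : ℕ} {p : MvPolynomial (Fin d) ℝ} (i : Fin d)
    (hp : p ∈ harmonicPoly d n) : pderiv i p ∈ harmonicPoly d (n - 1) := by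
  obtain ⟨hh, hl⟩ := Submodule.mem_inf.mp hp
  refine Submodule.mem_inf.mpr ⟨IsHomogeneous.pderiv hh, ?_⟩
  rw [LinearMap.mem_ker, polyLaplacian_apply] at hl ⊢
  simp_rw [pderiv_pderiv_comm _ i]
  rw [← map_sum, hl, map_zero]

/-- The linear form `y ↦ ⟨x, y⟩` as a polynomial. -/
def linearFormPoly {d : ℕ} (x : Fin d → ℝ) : MvPolynomial (Fin d) ℝ := ∑ i, C (x i) * X i

lemma pderiv_linearFormPoly {d : ℕ} (x : Fin d → ℝ) (i : Fin d) :
    pderiv i (linearFormPoly x) = C (x i) := by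
  simp [linearFormPoly, pderiv_X, Pi.single_apply]

lemma pderiv_normSqPoly {d : ℕ} (i : Fin d) : pderiv i (normSqPoly d) = 2 * X i := by
  simp [normSqPoly, pderiv_X, Pi.single_apply, Finset.sum_add_distrib]
  ring

lemma isHomogeneous_linearFormPoly {d : ℕ} (x : Fin d → ℝ) :
    (linearFormPoly x).IsHomogeneous 1 :=
  IsHomogeneous.sum _ _ _ fun i _ => by
    simpa using (isHomogeneous_C _ (x i)).mul (isHomogeneous_X ℝ i)

lemma restrictSphere_linearFormPoly {d : ℕ} (x y : UnitSphere d) :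
    restrictSphere (linearFormPoly fun i => (x : EuclideanSpace ℝ (Fin d)) i) y =
      inner ℝ (x : EuclideanSpace ℝ (Fin d)) (y : EuclideanSpace ℝ (Fin d)) := by
  simp [restrictSphere, linearFormPoly, PiLp.inner_apply, mul_comm]

lemma gaussianIntegral_linearFormPoly_mul {d : ℕ} (x : Fin d → ℝ) (p : MvPolynomial (Fin d) ℝ) :
    gaussianIntegral d (linearFormPoly x * p) =
      ∑ i, x i * gaussianIntegral d (pderiv i p) := by
  rw [linearFormPoly, Finset.sum_mul, map_sum]
  refine Finset.sum_congr rfl fun i _ => ?_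
  rw [mul_assoc, gaussianIntegral_C_mul, gaussianIntegral_X_mul]

/-- By Euler's and Stein's identities, `n` times the integral of `p` is the integral of `Δp`, which
is zero. For `n = 0`, `p` is constant, so any `x` will do; this is the base case of the next
induction. -/
lemma gaussianIntegral_harmonic {d n : ℕ} {p : MvPolynomial (Fin d) ℝ}
    (hp : p ∈ harmonicPoly d n) (x : Fin d → ℝ) :
    gaussianIntegral d p = if 0 = n then eval x p * gaussianIntegral d 1 else 0 := by
  obtain ⟨hh, hl⟩ := Submodule.mem_inf.mp hp
  split_ifs with hn
  · subst hn
    have hC := totalDegree_eq_zero_iff_eq_C.mp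
      (Nat.le_zero.mp (IsHomogeneous.totalDegree_le hh))
    rw [hC, eval_C, ← gaussianIntegral_C_mul, mul_one]
  · have h := congrArg (gaussianIntegral d) (IsHomogeneous.sum_X_mul_pderiv hh)
    simp_rw [map_sum, gaussianIntegral_X_mul] at h
    rw [← map_sum, ← polyLaplacian_apply, hl, map_zero, map_nsmul, nsmul_eq_mul] at h
    exact ((mul_eq_zero.mp h.symm).resolve_left (by exact_mod_cast Ne.symm hn))

/-- Harmonic polynomials of degree `n` are orthogonal to `⟨x, ·⟩ ^ k` for `k < n`, and the integral
against `⟨x, ·⟩ ^ n` is a multiple of the value at `x`. -/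
lemma gaussianIntegral_linearFormPoly_pow_mul {d : ℕ} (x : Fin d → ℝ) (k : ℕ) :
    ∀ (n : ℕ) (p : MvPolynomial (Fin d) ℝ), p ∈ harmonicPoly d n → k ≤ n →
      gaussianIntegral d (linearFormPoly x ^ k * p) =
        if k = n then n ! * eval x p * gaussianIntegral d 1 else 0 := by
  induction k using Nat.strong_induction_on with
  | _ k ih =>
    intro n p hp hkn
    obtain _ | k := k
    · rw [pow_zero, one_mul, gaussianIntegral_harmonic hp x]
      split_ifs with h
      · simp [← h]
      · rfl
    obtain ⟨n, rfl⟩ : ∃ m, n = m + 1 := ⟨n - 1, by omega⟩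
    have h1 : ∀ i, gaussianIntegral d (pderiv i (linearFormPoly x ^ k * p)) =
        if k = n then n ! * eval x (pderiv i p) * gaussianIntegral d 1 else 0 := fun i => by
      rw [pderiv_mul, map_add, ih k (by omega) n _ (pderiv_mem_harmonicPoly i hp) (by omega)]
      -- Differentiating the power leaves exponent `k - 1` against degree `n + 1`, which vanishes by
      -- induction. The exponent drops by two in all, hence the strong induction.
      have h0 : gaussianIntegral d (pderiv i (linearFormPoly x ^ k) * p) = 0 := by
        rw [pderiv_pow, pderiv_linearFormPoly]
        obtain _ | k := k
        · simp
        · have h2 : ((k + 1 : ℕ) : MvPolynomial (Fin d) ℝ) * linearFormPoly x ^ (k + 1 - 1) *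
              C (x i) * p = C ((k + 1 : ℕ) * x i) * (linearFormPoly x ^ k * p) := by
            rw [C_mul, map_natCast, Nat.add_sub_cancel]
            ring
          rw [h2, gaussianIntegral_C_mul, ih k (by omega) (n + 1) p hp (by omega),
            if_neg (by omega), mul_zero]
      rw [h0, zero_add]
    rw [pow_succ', mul_assoc, gaussianIntegral_linearFormPoly_mul]
    simp_rw [h1]
    by_cases hk : k = n
    · simp only [hk, if_true]
      -- Euler's identity at `x` supplies the factor `n + 1` that turns `n!` into `(n+1)!`.
      have he := congrArg (eval x) (IsHomogeneous.sum_X_mul_pderiv (Submodule.mem_inf.mp hp).1)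
      simp only [map_sum, map_mul, eval_X, nsmul_eq_mul, map_natCast] at he
      rw [Nat.factorial_succ, Nat.cast_mul, mul_comm ((n + 1 : ℕ) : ℝ), mul_assoc (n ! : ℝ), ← he,
        Finset.mul_sum, Finset.sum_mul]
      exact Finset.sum_congr rfl fun i _ => by ring
    · simp [hk]

lemma sum_X_mul_X_mul_eq_normSqPoly_mul {d : ℕ} (p : MvPolynomial (Fin d) ℝ) :
    ∑ i, X i * (X i * p) = normSqPoly d * p := by
  simp only [normSqPoly, Finset.sum_mul, mul_assoc]

/-- Stein's identity for the field `y |y|^(2k)`, whose divergence is `(d + 2k) |y|^(2k)`. -/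
lemma gaussianIntegral_normSqPoly_pow_succ (d k : ℕ) :
    gaussianIntegral d (normSqPoly d ^ (k + 1)) =
      (d + 2 * k) * gaussianIntegral d (normSqPoly d ^ k) := by
  have h : ∑ i, pderiv i (X i * normSqPoly d ^ k) = C ((d : ℝ) + 2 * k) * normSqPoly d ^ k := by
    simp_rw [pderiv_mul, pderiv_X_self, one_mul, pderiv_pow, pderiv_normSqPoly]
    rw [Finset.sum_add_distrib, Finset.sum_const, Finset.card_univ, Fintype.card_fin]
    have h1 : ∀ i : Fin d, X i * ((k : MvPolynomial (Fin d) ℝ) * normSqPoly d ^ (k - 1) *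
        (2 * X i)) = 2 * (k : MvPolynomial (Fin d) ℝ) * (X i * (X i * normSqPoly d ^ (k - 1))) := fun i => by ring
    simp_rw [h1]
    rw [← Finset.mul_sum, sum_X_mul_X_mul_eq_normSqPoly_mul, ← pow_succ']
    obtain _ | k := k
    · simp
    · simp only [Nat.add_sub_cancel, map_add, map_mul, map_natCast, map_ofNat, nsmul_eq_mul]
      ring
  rw [← gaussianIntegral_C_mul, ← h, map_sum, pow_succ', ← sum_X_mul_X_mul_eq_normSqPoly_mul,
    map_sum]
  simp_rw [gaussianIntegral_X_mul]

lemma poch_succ (a : ℝ) (k : ℕ) : poch a (k + 1) = poch a k * (a + k) :=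
  ascPochhammer_succ_eval k a

lemma poch_pos {a : ℝ} (ha : 0 < a) (k : ℕ) : 0 < poch a k :=
  ascPochhammer_pos k a ha

lemma gaussianIntegral_normSqPoly_pow (d k : ℕ) :
    gaussianIntegral d (normSqPoly d ^ k) =
      2 ^ k * poch ((d : ℝ) / 2) k * gaussianIntegral d 1 := by
  induction k with
  | zero => simp [poch]
  | succ k ih =>
    rw [gaussianIntegral_normSqPoly_pow_succ, ih, poch_succ]
    ring

/-- The means over the sphere of `⟨x, ·⟩ ^ (n - 2j)` times a harmonic polynomial of degree `n`. -/
lemma sphereMean_linearFormPoly_pow_mul {d n j : ℕ} (hd : 0 < d) (hj : 2 * j ≤ n)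
    (x : Fin d → ℝ) {p : MvPolynomial (Fin d) ℝ} (hp : p ∈ harmonicPoly d n) :
    sphereMean d (linearFormPoly x ^ (n - 2 * j) * p) =
      if j = 0 then n ! / (2 ^ n * poch ((d : ℝ) / 2) n) * eval x p else 0 := by
  have hh : (linearFormPoly x ^ (n - 2 * j) * p).IsHomogeneous (2 * (n - j)) := by
    have h := ((isHomogeneous_linearFormPoly x).pow (n - 2 * j)).mul (Submodule.mem_inf.mp hp).1
    rwa [show 1 * (n - 2 * j) + n = 2 * (n - j) by omega] at h
  have h := gaussianIntegral_eq_mul_sphereMean hd hh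
  rw [gaussianIntegral_linearFormPoly_pow_mul x _ n p hp (by omega),
    gaussianIntegral_normSqPoly_pow] at h
  have hd' : (0 : ℝ) < (d : ℝ) / 2 := by positivity
  have hG := gaussianIntegral_one_pos d
  have hP := poch_pos hd' (n - j)
  split_ifs with h0
  · subst h0
    rw [if_pos (by omega)] at h
    rw [Nat.sub_zero] at hP
    rw [mul_zero, Nat.sub_zero] at h ⊢
    rw [div_mul_eq_mul_div, eq_div_iff (by positivity)]
    refine mul_right_cancel₀ hG.ne' ?_
    rw [h]
    ring
  · rw [if_neg (by omega)] at h
    exact (mul_eq_zero.mp h.symm).resolve_left (by positivity)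

/-! ### Zonal harmonics -/

/-- Both sides are `(a)_(n+1)`. With `a = λ` this absorbs the factor `(n+λ)/λ`. -/
lemma poch_mul_add (a : ℝ) (n : ℕ) : poch a n * (a + n) = a * poch (a + 1) n := by
  induction n with
  | zero => simp [poch]
  | succ n ih =>
    rw [poch_succ, ih, poch_succ]
    push_cast
    ring

/-- The coefficients of the terminating hypergeometric series in the Gegenbauer polynomial. -/
def gegenbauerCoeff (lam : ℝ) (n j : ℕ) : ℝ :=
  poch (-(n : ℝ) / 2) j * poch ((1 - (n : ℝ)) / 2) j / (poch (1 - (n : ℝ) - lam) j * j !)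

lemma gegenbauerCoeff_zero (lam : ℝ) (n : ℕ) : gegenbauerCoeff lam n 0 = 1 := by
  simp [gegenbauerCoeff, poch]

/-- The ratio of consecutive hypergeometric terms, with denominators cleared into the shape produced
by the Laplacian. -/
lemma gegenbauerCoeff_succ {lam : ℝ} (hlam : 0 < lam) {n j : ℕ} (hj : j + 1 ≤ n) :
    gegenbauerCoeff lam n (j + 1) * (4 * (j + 1) * (n + lam - 1 - j)) =
      -(gegenbauerCoeff lam n j * ((n - 2 * j) * (n - 2 * j - 1))) := by
  have hj' : ((j : ℝ) + 1) ≤ n := by exact_mod_cast hj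
  have h1 : (1 - (n : ℝ) - lam + j) ≠ 0 := by linarith
  have h2 : ((j : ℝ) + 1) ≠ 0 := by positivity
  have h3 : gegenbauerCoeff lam n (j + 1) = gegenbauerCoeff lam n j *
      ((-(n : ℝ) / 2 + j) * ((1 - (n : ℝ)) / 2 + j) / ((1 - (n : ℝ) - lam + j) * (j + 1))) := by
    simp only [gegenbauerCoeff, poch_succ, Nat.factorial_succ, Nat.cast_mul, Nat.cast_succ]
    rw [div_mul_div_comm]
    congr 1 <;> ring
  rw [h3]
  field_simp
  ring

/-! ### Harmonicity of the zonal polynomial -/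

lemma sum_X_mul_C_eq_linearFormPoly {d : ℕ} (x : Fin d → ℝ) :
    ∑ i, X i * C (x i) = linearFormPoly x := by
  simp only [linearFormPoly, mul_comm]

lemma polyLaplacian_mul {d : ℕ} (f g : MvPolynomial (Fin d) ℝ) :
    polyLaplacian d (f * g) = polyLaplacian d f * g + 2 * ∑ i, pderiv i f * pderiv i g +
      f * polyLaplacian d g := by
  simp only [polyLaplacian_apply, Finset.sum_mul, Finset.mul_sum, ← Finset.sum_add_distrib]
  refine Finset.sum_congr rfl fun i _ => ?_
  simp only [pderiv_mul, map_add]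
  ring

lemma polyLaplacian_linearFormPoly_pow {d : ℕ} {x : Fin d → ℝ} (hx : ∑ i, x i ^ 2 = 1) (m : ℕ) :
    polyLaplacian d (linearFormPoly x ^ m) =
      C ((m : ℝ) * (m - 1)) * linearFormPoly x ^ (m - 2) := by
  have h : ∀ i, pderiv i (pderiv i (linearFormPoly x ^ m)) =
      C (x i ^ 2) * (C ((m : ℝ) * (m - 1)) * linearFormPoly x ^ (m - 2)) := fun i => by
    simp only [pderiv_pow, pderiv_linearFormPoly, pderiv_mul, pderiv_C, Derivation.map_natCast]
    obtain _ | m := m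
    · simp
    · simp only [Nat.add_sub_cancel, show m + 1 - 2 = m - 1 by omega, map_mul, map_sub,
        map_natCast, C_1, map_pow]
      push_cast
      ring
  rw [polyLaplacian_apply]
  simp_rw [h]
  rw [← Finset.sum_mul, ← map_sum, hx, C_1, one_mul]

lemma polyLaplacian_normSqPoly_pow (d j : ℕ) :
    polyLaplacian d (normSqPoly d ^ j) =
      C (2 * (j : ℝ) * (d + 2 * j - 2)) * normSqPoly d ^ (j - 1) := by
  have h : ∀ i : Fin d, pderiv i (pderiv i (normSqPoly d ^ j)) =
      C (2 * (j : ℝ)) * normSqPoly d ^ (j - 1) +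
        C (4 * (j : ℝ) * (j - 1)) * (X i * (X i * normSqPoly d ^ (j - 2))) := fun i => by
    simp only [pderiv_pow, pderiv_normSqPoly, pderiv_mul, pderiv_X_self, Derivation.map_natCast,
      show pderiv i (2 : MvPolynomial (Fin d) ℝ) = 0 from Derivation.map_natCast _ 2]
    obtain _ | j := j
    · simp
    · simp only [Nat.add_sub_cancel, show j + 1 - 2 = j - 1 by omega, map_mul, map_sub,
        map_natCast, C_1, map_ofNat]
      push_cast
      ring
  rw [polyLaplacian_apply]
  simp_rw [h]
  rw [Finset.sum_add_distrib, Finset.sum_const, Finset.card_univ, Fintype.card_fin,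
    ← Finset.mul_sum, sum_X_mul_X_mul_eq_normSqPoly_mul, ← pow_succ']
  obtain _ | _ | j := j
  · simp
  · simp
    ring
  · simp only [Nat.add_sub_cancel, show j + 1 + 1 - 2 + 1 = j + 1 by omega, map_mul, map_sub,
      map_add, map_natCast, C_1, map_ofNat, nsmul_eq_mul]
    push_cast
    ring

lemma polyLaplacian_normSqPoly_pow_mul {d : ℕ} {x : Fin d → ℝ} (hx : ∑ i, x i ^ 2 = 1)
    (j m : ℕ) :
    polyLaplacian d (normSqPoly d ^ j * linearFormPoly x ^ m) =
      C (2 * (j : ℝ) * (d + 2 * j - 2 + 2 * m)) *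
          (normSqPoly d ^ (j - 1) * linearFormPoly x ^ m) +
        C ((m : ℝ) * (m - 1)) * (normSqPoly d ^ j * linearFormPoly x ^ (m - 2)) := by
  have h : ∑ i, pderiv i (normSqPoly d ^ j) * pderiv i (linearFormPoly x ^ m) =
      C (2 * (j : ℝ) * m) * (normSqPoly d ^ (j - 1) * linearFormPoly x ^ m) := by
    have h1 : ∀ i, pderiv i (normSqPoly d ^ j) * pderiv i (linearFormPoly x ^ m) =
        C (2 * (j : ℝ) * m) * (normSqPoly d ^ (j - 1) * linearFormPoly x ^ (m - 1)) *
          (X i * C (x i)) := fun i => by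
      simp only [pderiv_pow, pderiv_normSqPoly, pderiv_linearFormPoly, map_mul, map_natCast,
        map_ofNat]
      ring
    simp_rw [h1]
    rw [← Finset.mul_sum, sum_X_mul_C_eq_linearFormPoly]
    obtain _ | m := m
    · simp
    · rw [Nat.add_sub_cancel, pow_succ]
      ring
  rw [polyLaplacian_mul, polyLaplacian_linearFormPoly_pow hx, polyLaplacian_normSqPoly_pow, h]
  simp only [map_mul, map_add, map_sub, map_natCast, map_ofNat, C_1]
  ring

/-- The zonal polynomial with pole `x`, the homogenization of
`(n + λ) / λ * C_n^λ(⟨x, ·⟩)`. -/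
def zonalPoly {d : ℕ} (lam : ℝ) (n : ℕ) (x : Fin d → ℝ) : MvPolynomial (Fin d) ℝ :=
  C (((n : ℝ) + lam) / lam * (poch lam n * 2 ^ n / n !)) *
    ∑ j ∈ Finset.range (n / 2 + 1),
      C (gegenbauerCoeff lam n j) * (normSqPoly d ^ j * linearFormPoly x ^ (n - 2 * j))

lemma isHomogeneous_zonalPoly {d : ℕ} (lam : ℝ) (n : ℕ) (x : Fin d → ℝ) :
    (zonalPoly lam n x).IsHomogeneous n := by
  rw [zonalPoly, ← zero_add n]
  refine (isHomogeneous_C _ _).mul (IsHomogeneous.sum _ _ _ fun j hj => ?_)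
  have hj' : 2 * j ≤ n := by rw [zero_add, Finset.mem_range] at hj; omega
  have h := (isHomogeneous_C (Fin d) (gegenbauerCoeff lam n j)).mul
    (((isHomogeneous_normSqPoly d).pow j).mul
      ((isHomogeneous_linearFormPoly x).pow (n - 2 * j)))
  rw [show 0 + (2 * j + 1 * (n - 2 * j)) = n by omega] at h
  simpa only [zero_add] using h

lemma polyLaplacian_C_mul {d : ℕ} (c : ℝ) (p : MvPolynomial (Fin d) ℝ) :
    polyLaplacian d (C c * p) = C c * polyLaplacian d p := by
  rw [C_mul', C_mul', map_smul]

lemma polyLaplacian_zonalPoly {d : ℕ} (n : ℕ) {lam : ℝ} (hlam : lam = ((d : ℝ) - 2) / 2)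
    (hpos : 0 < lam) {x : Fin d → ℝ} (hx : ∑ i, x i ^ 2 = 1) :
    polyLaplacian d (zonalPoly lam n x) = 0 := by
  -- The Laplacian of the `j`-th term is `S j + T j`: `S` lowers the power of `|y|²`, `T` that of
  -- `⟨x,y⟩`. Thus `S (j + 1)` and `T j` carry the same product and the sum telescopes.
  let T : ℕ → MvPolynomial (Fin d) ℝ := fun j =>
    C (gegenbauerCoeff lam n j * (((n : ℝ) - 2 * j) * (n - 2 * j - 1))) *
      (normSqPoly d ^ j * linearFormPoly x ^ (n - 2 * j - 2))
  let S : ℕ → MvPolynomial (Fin d) ℝ := fun j =>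
    C (gegenbauerCoeff lam n j * (2 * (j : ℝ) * (d + 2 * j - 2 + 2 * (n - 2 * j)))) *
      (normSqPoly d ^ (j - 1) * linearFormPoly x ^ (n - 2 * j))
  have hterm : ∀ j ∈ Finset.range (n / 2 + 1), polyLaplacian d (C (gegenbauerCoeff lam n j) *
      (normSqPoly d ^ j * linearFormPoly x ^ (n - 2 * j))) = S j + T j := fun j hj => by
    have hj' : 2 * j ≤ n := by rw [Finset.mem_range] at hj; omega
    rw [polyLaplacian_C_mul, polyLaplacian_normSqPoly_pow_mul hx]
    simp only [S, T, Nat.cast_sub hj', Nat.cast_mul, Nat.cast_ofNat, C_mul]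
    ring
  have hST : ∀ j ∈ Finset.range (n / 2), S (j + 1) = -T j := fun j hj => by
    have hj' : j + 1 ≤ n := by rw [Finset.mem_range] at hj; omega
    have h := gegenbauerCoeff_succ hpos hj'
    -- Here `λ = (d-2)/2` enters: it makes the factor in `S (j + 1)` equal to `4(j+1)(n+λ-1-j)`.
    have hd : (d : ℝ) = 2 * lam + 2 := by rw [hlam]; ring
    simp only [S, T, Nat.add_sub_cancel, show n - 2 * (j + 1) = n - 2 * j - 2 by omega]
    rw [← neg_mul, ← C_neg, ← h, hd]
    congr 2
    push_cast
    ring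
  have hS0 : S 0 = 0 := by simp [S]
  have hT : T (n / 2) = 0 := by
    -- The last exponent `n - 2⌊n/2⌋` is 0 or 1, so its second derivative vanishes.
    have h : ((n : ℝ) - 2 * (n / 2 : ℕ)) * (n - 2 * (n / 2 : ℕ) - 1) = 0 := by
      obtain ⟨k, hk | hk⟩ := Nat.even_or_odd' n
      · have h2 : n / 2 = k := by omega
        rw [h2, hk]
        push_cast
        ring
      · have h2 : n / 2 = k := by omega
        rw [h2, hk]
        push_cast
        ring
    simp only [T, h, mul_zero, C_0, zero_mul]
  rw [zonalPoly, polyLaplacian_C_mul, map_sum, Finset.sum_congr rfl hterm,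
    Finset.sum_add_distrib, Finset.sum_range_succ' S, Finset.sum_range_succ T, hS0, hT,
    Finset.sum_congr rfl hST, Finset.sum_neg_distrib]
  simp

lemma zonalPoly_mem_harmonicPoly {d : ℕ} (n : ℕ) {lam : ℝ} (hlam : lam = ((d : ℝ) - 2) / 2)
    (hpos : 0 < lam) {x : Fin d → ℝ} (hx : ∑ i, x i ^ 2 = 1) :
    zonalPoly lam n x ∈ harmonicPoly d n :=
  Submodule.mem_inf.mpr
    ⟨isHomogeneous_zonalPoly lam n x, polyLaplacian_zonalPoly n hlam hpos hx⟩

lemma restrictSphere_zonalPoly {d : ℕ} (lam : ℝ) (n : ℕ) (x y : UnitSphere d) :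
    restrictSphere (zonalPoly lam n fun i => (x : EuclideanSpace ℝ (Fin d)) i) y =
      ((n : ℝ) + lam) / lam * (gegenbauer lam n).eval
        (inner ℝ (x : EuclideanSpace ℝ (Fin d)) (y : EuclideanSpace ℝ (Fin d))) := by
  have h1 := restrictSphere_normSqPoly y
  have h2 := restrictSphere_linearFormPoly x y
  unfold restrictSphere at h1 h2 ⊢
  simp only [zonalPoly, map_mul, map_sum, map_pow, eval_C, h1, h2, one_pow, one_mul, gegenbauer,
    Polynomial.eval_mul, Polynomial.eval_C, Polynomial.eval_finsetSum, Polynomial.eval_pow,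
    Polynomial.eval_X, gegenbauerCoeff, mul_assoc]

/-! ### The reproducing property -/

lemma sphereMean_congr {d : ℕ} {p q : MvPolynomial (Fin d) ℝ}
    (h : restrictSphere p = restrictSphere q) : sphereMean d p = sphereMean d q := by
  simp only [sphereMean, LinearMap.coe_mk, AddHom.coe_mk, h]

/-- The reproducing property of the zonal polynomials. -/
lemma sphereMean_zonalPoly_mul {d n : ℕ} (hd : 0 < d) {lam : ℝ}
    (hlam : lam = ((d : ℝ) - 2) / 2) (hpos : 0 < lam) (x : Fin d → ℝ)
    {p : MvPolynomial (Fin d) ℝ} (hp : p ∈ harmonicPoly d n) :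
    sphereMean d (zonalPoly lam n x * p) = eval x p := by
  have h : ∀ j ∈ Finset.range (n / 2 + 1),
      sphereMean d (C (gegenbauerCoeff lam n j) *
        (normSqPoly d ^ j * linearFormPoly x ^ (n - 2 * j)) * p) =
      if j = 0 then n ! / (2 ^ n * poch ((d : ℝ) / 2) n) * eval x p else 0 := fun j hj => by
    have hj' : 2 * j ≤ n := by rw [Finset.mem_range] at hj; omega
    have h1 : sphereMean d (normSqPoly d ^ j * (linearFormPoly x ^ (n - 2 * j) * p)) =
        sphereMean d (linearFormPoly x ^ (n - 2 * j) * p) :=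
      sphereMean_congr <| funext fun y => by
        have h2 := restrictSphere_normSqPoly y
        unfold restrictSphere at h2 ⊢
        rw [map_mul, map_pow, h2, one_pow, one_mul]
    rw [mul_assoc, C_mul', map_smul, mul_assoc, h1,
      sphereMean_linearFormPoly_pow_mul hd hj' x hp]
    split_ifs with h0
    · rw [h0, gegenbauerCoeff_zero, one_smul]
    · rw [smul_zero]
  have hd2 : (d : ℝ) / 2 = lam + 1 := by rw [hlam]; ring
  have hP := poch_pos (a := lam + 1) (by linarith) n
  have hm := poch_mul_add lam n
  rw [zonalPoly, mul_assoc, C_mul', map_smul, Finset.sum_mul, map_sum, Finset.sum_congr rfl h,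
    Finset.sum_ite_eq' _ 0, if_pos (by simp), hd2, smul_eq_mul, ← mul_assoc]
  -- Since `d/2 = λ+1` and `(n+λ)(λ)_n = λ(λ+1)_n`, the normalization is exactly the inverse of the
  -- constant in the mean.
  have h3 : ((n : ℝ) + lam) / lam * (poch lam n * 2 ^ n / n !) *
      (n ! / (2 ^ n * poch (lam + 1) n)) = 1 := by
    have hf : (n ! : ℝ) ≠ 0 := by positivity
    field_simp
    linarith
  rw [h3, one_mul]

lemma sum_sq_eq_one {d : ℕ} (x : UnitSphere d) :
    ∑ i, (x : EuclideanSpace ℝ (Fin d)) i ^ 2 = 1 := by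
  have h := restrictSphere_normSqPoly x
  simpa [restrictSphere, normSqPoly, ← pow_two] using h

lemma sphereInner_comm {d : ℕ} (f g : UnitSphere d → ℝ) : sphereInner f g = sphereInner g f := by
  simp only [sphereInner, mul_comm]

end

theorem mainTheorem1 (d : ℕ) (hd : 3 ≤ d) (n : ℕ) (lam : ℝ) (hlam : lam = ((d : ℝ) - 2) / 2) :
    (∃! Z : UnitSphere d → UnitSphere d → ℝ, IsReproducingKernel d n Z) ∧
    (∀ Z : UnitSphere d → UnitSphere d → ℝ, IsReproducingKernel d n Z →
      ∀ x y : UnitSphere d, Z x y = ((n : ℝ) + lam) / lam *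
        (gegenbauer lam n).eval
          (inner ℝ (x : EuclideanSpace ℝ (Fin d)) (y : EuclideanSpace ℝ (Fin d)))) ∧
    (∀ (ι : Type*) [Fintype ι] (Y : Module.Basis ι ℝ (harmonicPoly d n)),
      IsSphereOrthonormal Y →
      ∀ x y : UnitSphere d,
        ∑ j, restrictSphere (Y j : MvPolynomial (Fin d) ℝ) x *
            restrictSphere (Y j : MvPolynomial (Fin d) ℝ) y =
          ((n : ℝ) + lam) / lam *
            (gegenbauer lam n).eval
              (inner ℝ (x : EuclideanSpace ℝ (Fin d)) (y : EuclideanSpace ℝ (Fin d)))) := by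
  have hd0 : 0 < d := by omega
  have hpos : 0 < lam := by
    have h : (3 : ℝ) ≤ d := by exact_mod_cast hd
    rw [hlam]
    linarith
  let q : UnitSphere d → MvPolynomial (Fin d) ℝ := fun x =>
    zonalPoly lam n fun i => (x : EuclideanSpace ℝ (Fin d)) i
  have hq : ∀ x, q x ∈ harmonicPoly d n := fun x =>
    zonalPoly_mem_harmonicPoly n hlam hpos (sum_sq_eq_one x)
  have hrep : ∀ p ∈ harmonicPoly d n, ∀ x,
      sphereInner (restrictSphere (q x)) (restrictSphere p) = restrictSphere p x :=
    fun p hp x => by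
      rw [sphereInner_restrictSphere, sphereMean_zonalPoly_mul hd0 hlam hpos _ hp]
      rfl
  have hker : IsReproducingKernel d n fun x => restrictSphere (q x) :=
    ⟨fun x => ⟨q x, hq x, rfl⟩, hrep⟩
  have hsymm : ∀ x y, restrictSphere (q y) x = restrictSphere (q x) y := fun x y => by
    simp only [q, restrictSphere_zonalPoly, real_inner_comm]
  -- Pair `Z(x,·)` with the zonal `q y`: reproduction by `q y` gives `Z(x,y)`, reproduction by `Z`
  -- gives `q y` at `x`, and symmetry concludes.
  have huniq : ∀ Z, IsReproducingKernel d n Z → ∀ x y, Z x y = restrictSphere (q x) y :=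
    fun Z hZ x y => by
      obtain ⟨r, hr, hrZ⟩ := hZ.mem x
      rw [hrZ, ← hrep r hr y, ← hrZ, sphereInner_comm, hZ.reproducing _ (hq y) x, hsymm]
  refine ⟨⟨_, hker, fun Z hZ => funext fun x => funext fun y => huniq Z hZ x y⟩,
    fun Z hZ x y => (huniq Z hZ x y).trans (restrictSphere_zonalPoly lam n x y),
    fun ι _ Y hY x y => ?_⟩
  rw [← restrictSphere_zonalPoly]
  change _ = restrictSphere (q x) y
  have hsum : q x = ∑ j, Y.repr ⟨q x, hq x⟩ j • (Y j : MvPolynomial (Fin d) ℝ) := by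
    have h := congrArg (Submodule.subtype _) (Y.sum_repr ⟨q x, hq x⟩)
    rw [map_sum] at h
    exact h.symm
  -- By orthonormality the coefficient is the inner product of `q x` with `Y j`, which the
  -- reproducing property evaluates as `Y j` at `x`.
  have hcoef : ∀ j, Y.repr ⟨q x, hq x⟩ j = restrictSphere (Y j : MvPolynomial (Fin d) ℝ) x :=
    fun j => by
      rw [← hrep _ (Y j).2 x, sphereInner_restrictSphere]
      conv_rhs => rw [hsum]
      rw [Finset.sum_mul, map_sum, Finset.sum_eq_single j]
      · rw [smul_mul_assoc, map_smul, ← sphereInner_restrictSphere, hY.norm_one, smul_eq_mul,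
          mul_one]
      · intro i _ hij
        rw [smul_mul_assoc, map_smul, ← sphereInner_restrictSphere, hY.orthogonal i j hij,
          smul_zero]
      · simp
  rw [hsum]
  simp only [hcoef, restrictSphere, map_sum, MvPolynomial.smul_eval]
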